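/- Let $N,W,L$ be positive integers with $W\le N$. Put $\alpha=\gcd(L,N)$ and $R=N/\alpha$, and assume $R\ge 3$ and $W\ge \alpha+2$. For $x\in\mathbb C^N$, with indices read modulo $N$, for $w\in\mathbb C^W$ and $k\in\mathbb Z$, let $$y_k(x,w)=\bigl(x[k]w[0],\,x[k-1]w[1],\,\dots,\,x[k-(W-1)]w[W-1]\bigr)\in\mathbb C^W .$$ Let $Z\subset(\mathbb C^W)^3$ be the closure of the image of the map $\mathbb C^N\times\mathbb C^W\to(\mathbb C^W)^3$, $(x,w)\mapsto (y_0,y_\alpha,y_{-\alpha})$. For $y\in\mathbb C^W$ let $A_y(\omega)=\bigl|\sum_{n=0}^{W-1}y[n]\omega^n\bigr|^2$, $\omega\in S^1$, be its Fourier intensity function. Then for generic $(z_0,z_\alpha,z_{-\alpha})\in Z$ the following holds: if $(z'_0,z'_\alpha,z'_{-\alpha})\in Z$ satisfies $A_{z'_j}=A_{z_j}$ on $S^1$ for $j=0,\alpha,-\alpha$, then there are angles $\theta_0,\theta_\alpha\in\mathbb R$ such that $$z'_0=e^{i\theta_0}z_0,\qquad z'_\alpha=e^{i(\theta_0+\theta_\alpha)}z_\alpha,\qquad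 z'_{-\alpha}=e^{i(\theta_0-\theta_\alpha)}z_{-\alpha}.$$ Here "generic" means: there is a polynomial with real coefficients in the real and imaginary parts of the $3W$ coordinates that does not vanish identically on $Z$, such that the assertion holds for every point of $Z$ at which the polynomial is non-zero. -/

import Mathlib

noncomputable section

namespace BlindSTFT

/-- The windowed section `y_k(x, w) = (x[k] w[0], x[k-1] w[1], …, x[k-(W-1)] w[W-1])` of an
`N`-periodic signal `x`; indices of `x` are taken modulo `N`. -/
def windowedSection {N W : ℕ} (x : ZMod N → ℂ) (w : Fin W → ℂ) (k : ℤ) : Fin W → ℂ :=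
  fun n => x (((k - (n : ℕ) : ℤ)) : ZMod N) * w n

/-- The map `(x, w) ↦ (y_0, y_α, y_{-α})`. A triple `z` of vectors of `ℂ^W` is stored as a function
on `Fin 3`, with `z 0 = z_0`, `z 1 = z_α` and `z 2 = z_{-α}`. -/
def tripleMap (N W α : ℕ) (p : (ZMod N → ℂ) × (Fin W → ℂ)) : Fin 3 → Fin W → ℂ :=
  ![windowedSection p.1 p.2 0, windowedSection p.1 p.2 (α : ℤ),
    windowedSection p.1 p.2 (-(α : ℤ))]

/-- The set `Z ⊆ (ℂ^W)^3`: the closure of the image of `(x, w) ↦ (y_0, y_α, y_{-α})`. (The image of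
a complex polynomial map is constructible, so its Zariski and Euclidean closures coincide.) -/
def tripleVariety (N W α : ℕ) : Set (Fin 3 → Fin W → ℂ) :=
  closure (Set.range (tripleMap N W α))

/-- The Fourier intensity function `A_y(ω) = |y[0] + y[1] ω + … + y[W-1] ω^(W-1)|²` on the unit
circle. -/
def fourierIntensity {W : ℕ} (y : Fin W → ℂ) (ω : Circle) : ℝ :=
  ‖∑ n : Fin W, y n * (ω : ℂ) ^ (n : ℕ)‖ ^ 2

/-- The value at `z` of a real polynomial in the real parts (`Sum.inl`) and the imaginary parts
(`Sum.inr`) of the entries of the triple `z`. -/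
def evalReIm {W : ℕ} (q : MvPolynomial ((Fin 3 × Fin W) ⊕ (Fin 3 × Fin W)) ℝ)
    (z : Fin 3 → Fin W → ℂ) : ℝ :=
  MvPolynomial.eval
    (Sum.elim (fun i => (z i.1 i.2).re) (fun i => (z i.1 i.2).im)) q

/-- `P` holds for generic `z ∈ Z`, for an irreducible `Z`: the points of `Z` where `P` fails lie in
the zero set of a real polynomial that does not vanish identically on `Z`. -/
def HoldsGenerically {W : ℕ} (Z : Set (Fin 3 → Fin W → ℂ))
    (P : (Fin 3 → Fin W → ℂ) → Prop) : Prop :=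
  ∃ q : MvPolynomial ((Fin 3 × Fin W) ⊕ (Fin 3 × Fin W)) ℝ,
    (∃ z ∈ Z, evalReIm q z ≠ 0) ∧ ∀ z ∈ Z, evalReIm q z ≠ 0 → P z

end BlindSTFT

end


/-!
On the unit circle the conjugate of the polynomial `y(ω)` with coefficients `y` is, up to a power of
`ω`, the polynomial with the conjugate reversed coefficients. Equal Fourier intensities therefore
mean that the roots of `z'_j` are, for some `l_j`, `l_j` of the `d = W - 1` roots of `z_j` together
with `d - l_j` of the roots of its conjugate reversal. Both triples satisfy the binomial relations
`z₀[n] z₀[n + α] = z₋[n] z₊[n + α]`, and at a generic point these exclude every exchange of roots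
with some `l_j ≠ d`. A polynomial in `z` and `star z` can be tested at two independent points of the
image, so one witness suffices for each `(l_0, l_α, l_{-α})`: at the first point all roots of `z_j`
equal one small number, at the second (a chirp) all roots of the conjugate reversal of `z_j` equal a
point of the unit circle that depends on `j`, and the relations fail in their lowest or highest
order in the small number. For `l = 0` a signal with a single peak is used instead. Lying over,
applied to the passage from coefficients to roots, turns the resulting condition on the roots into
one on the coefficients. Once `l_j = d` for all `j`, `z'_j` is a unimodular multiple of `z_j`, and
one binomial relation ties the three phases together.
-/

namespace BlindSTFT

open Polynomial

section Elimination

variable {R κ : Type*} [CommRing R] {d : ℕ}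

/-- The non-leading coefficients of the monic polynomial `∏ i, (X - r i)` with roots `r`. -/
noncomputable def rootCoeff (r : Fin d → R) (n : Fin d) : R :=
  (∏ i, (X - C (r i))).coeff n

lemma map_rootCoeff {S : Type*} [CommRing S] (φ : R →+* S) (r : Fin d → R) (n : Fin d) :
    φ (rootCoeff r n) = rootCoeff (fun i => φ (r i)) n := by
  simp [rootCoeff, ← coeff_map, Polynomial.map_prod]

lemma prod_X_sub_C_eq_X_pow_add_sum (r : Fin d → R) :
    ∏ i, (X - C (r i)) = X ^ d + ∑ n, C (rootCoeff r n) * X ^ (n : ℕ) := by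
  nontriviality R
  have hdeg : (∏ i, (X - C (r i))).natDegree = d := by
    simp [natDegree_finsetProd_X_sub_C_eq_card]
  rw [(monic_prod_X_sub_C r _).as_sum, hdeg, Finset.sum_range]
  rfl

lemma eq_of_rootCoeff_eq_const [IsDomain R] {r : Fin d → R} {b : R}
    (h : rootCoeff r = rootCoeff fun _ => b) (i : Fin d) : r i = b := by
  have hprod : ∏ j, (X - C (r j)) = ∏ _j : Fin d, (X - C b) := by
    rw [prod_X_sub_C_eq_X_pow_add_sum, h, ← prod_X_sub_C_eq_X_pow_add_sum]
  replace hprod := congrArg (eval (r i)) hprod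
  simp only [eval_prod, eval_sub, eval_X, eval_C] at hprod
  rw [Finset.prod_eq_zero (Finset.mem_univ i) (sub_self _), Finset.prod_const] at hprod
  exact sub_eq_zero.1 (eq_zero_of_pow_eq_zero hprod.symm)

variable (R κ d) in
/-- The substitution of the coefficients of `∏ i, (T - X (k, i))` for the variables `X (k, n)`: it
embeds the polynomial functions of the coefficients of a family, indexed by `κ`, of monic
polynomials of degree `d` into the polynomial functions of their roots. -/
noncomputable def rootCoeffHom : MvPolynomial (κ × Fin d) R →ₐ[R] MvPolynomial (κ × Fin d) R :=
  MvPolynomial.bind₁ fun t => rootCoeff (fun i => MvPolynomial.X (t.1, i)) t.2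

lemma eval_rootCoeffHom (r : κ → Fin d → R) (P : MvPolynomial (κ × Fin d) R) :
    MvPolynomial.eval r.uncurry (rootCoeffHom R κ d P) =
      MvPolynomial.eval (Function.uncurry fun k => rootCoeff (r k)) P := by
  rw [rootCoeffHom, MvPolynomial.eval, MvPolynomial.eval₂Hom_bind₁]
  congr 2 with t
  exact (map_rootCoeff _ _ _).trans (by simp [Function.uncurry])

lemma isIntegralElem_of_rootCoeff_eq {A : Type*} [CommRing A] {φ : A →+* R} {r : Fin d → R}
    {a : Fin d → A} (h : ∀ n, φ (a n) = rootCoeff r n) (i : Fin d) : φ.IsIntegralElem (r i) := by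
  refine ⟨X ^ d + ∑ n, C (a n) * X ^ (n : ℕ), monic_X_pow_add (degree_sum_fin_lt a), ?_⟩
  have hmap : (X ^ d + ∑ n, C (a n) * X ^ (n : ℕ)).map φ = ∏ j, (X - C (r j)) := by
    simp [prod_X_sub_C_eq_X_pow_add_sum, Polynomial.map_sum, h]
  rw [← eval_map, hmap, eval_prod]
  exact Finset.prod_eq_zero (Finset.mem_univ i) (by simp)

lemma isIntegral_rootCoeffHom : (rootCoeffHom R κ d).toRingHom.IsIntegral := by
  intro p
  induction p using MvPolynomial.induction_on with
  | C a =>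
    have hC : (rootCoeffHom R κ d).toRingHom (MvPolynomial.C a) = MvPolynomial.C a :=
      (rootCoeffHom R κ d).commutes a
    exact hC ▸ RingHom.isIntegralElem_map _
  | add p q hp hq => exact hp.add _ hq
  | mul_X p t hp =>
    refine hp.mul _ (isIntegralElem_of_rootCoeff_eq (r := fun i => MvPolynomial.X (t.1, i))
      (a := fun n => MvPolynomial.X (t.1, n)) (fun n => ?_) t.2)
    exact MvPolynomial.bind₁_X_right _ _

lemma exists_isPrime_comap_eq_of_isIntegral {A B : Type*} [CommRing A] [CommRing B] {φ : A →+* B}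
    (hφ : φ.IsIntegral) (m : Ideal A) [m.IsPrime] {I : Ideal B} (hI : I.comap φ ≤ m) :
    ∃ Q ≥ I, Q.IsPrime ∧ Q.comap φ = m := by
  algebraize [φ]
  exact Ideal.exists_ideal_over_prime_of_isIntegral m I hI

lemma eval_eq_zero_of_isPrime_mem {P : MvPolynomial (κ × Fin d) R} {b : κ → R}
    {Q : Ideal (MvPolynomial (κ × Fin d) R)} [Q.IsPrime] (hP : P ∈ Q)
    (hQ : Q.comap (rootCoeffHom R κ d) = RingHom.ker
      (MvPolynomial.eval (Function.uncurry fun k => rootCoeff fun _ : Fin d => b k))) :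
    MvPolynomial.eval (fun t => b t.1) P = 0 := by
  let π := Ideal.Quotient.mk Q
  have hmem (p) : π (rootCoeffHom R κ d p) = 0 ↔ MvPolynomial.eval
      (Function.uncurry fun k => rootCoeff fun _ : Fin d => b k) p = 0 := by
    rw [Ideal.Quotient.eq_zero_iff_mem, ← Ideal.mem_comap, hQ, RingHom.mem_ker]
  have hX (k : κ) (i : Fin d) : π (MvPolynomial.X (k, i)) = π (MvPolynomial.C (b k)) := by
    refine eq_of_rootCoeff_eq_const (r := fun i => π (MvPolynomial.X (k, i))) (funext fun n => ?_) i
    have h := (hmem (MvPolynomial.X (k, n) - MvPolynomial.C (rootCoeff (fun _ => b k) n))).2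
      (by simp [Function.uncurry])
    rw [map_sub, map_sub, sub_eq_zero, rootCoeffHom, MvPolynomial.bind₁_X_right,
      MvPolynomial.bind₁_C_right] at h
    simpa only [map_rootCoeff] using h
  have hπ : π = (π.comp MvPolynomial.C).comp (MvPolynomial.eval fun t => b t.1) :=
    MvPolynomial.ringHom_ext (by simp) (by simp [hX])
  have hC : π (MvPolynomial.C (MvPolynomial.eval (fun t => b t.1) P)) = 0 :=
    (DFunLike.congr_fun hπ P).symm.trans (Ideal.Quotient.eq_zero_iff_mem.2 hP)
  simpa using (hmem (MvPolynomial.C _)).1 (by simpa [rootCoeffHom] using hC)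

/- Otherwise lying over gives a prime `Q ∋ P` above the maximal ideal of the coefficients of
`(T - b k) ^ d`; modulo `Q` all roots `X (k, i)` equal `b k`, so that `eval b P = 0`. -/
lemma exists_eval_rootCoeff_ne_zero [IsDomain R] {P : MvPolynomial (κ × Fin d) R} {b : κ → R}
    (hP : MvPolynomial.eval (fun t => b t.1) P ≠ 0) :
    ∃ P' : MvPolynomial (κ × Fin d) R,
      MvPolynomial.eval (Function.uncurry fun k => rootCoeff fun _ => b k) P' ≠ 0 ∧
      ∀ r : κ → Fin d → R, MvPolynomial.eval r.uncurry P = 0 →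
        MvPolynomial.eval (Function.uncurry fun k => rootCoeff (r k)) P' = 0 := by
  let m := RingHom.ker
    (MvPolynomial.eval (Function.uncurry fun k => rootCoeff fun _ : Fin d => b k))
  have : m.IsPrime := RingHom.ker_isPrime _
  suffices h : ¬ (Ideal.span {P}).comap (rootCoeffHom R κ d) ≤ m by
    obtain ⟨P', hP', hm⟩ := SetLike.not_le_iff_exists.1 h
    refine ⟨P', hm, fun r hr => ?_⟩
    obtain ⟨S, hS⟩ := Ideal.mem_span_singleton.1 (Ideal.mem_comap.1 hP')
    rw [← eval_rootCoeffHom, hS, map_mul, hr, zero_mul]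
  intro hle
  obtain ⟨Q, hQ, _, hQm⟩ := exists_isPrime_comap_eq_of_isIntegral isIntegral_rootCoeffHom m hle
  exact hP (eval_eq_zero_of_isPrime_mem (hQ (Ideal.mem_span_singleton_self P)) hQm)

end Elimination

section ClearingDenominators

variable {K κ σ τ : Type*} [Field K]

lemma exists_eval_eq_mul_eval_div (m e : τ → MvPolynomial σ K) (p : MvPolynomial τ K) :
    ∃ Q E : MvPolynomial σ K, ∀ v : σ → K, (∀ t, MvPolynomial.eval v (e t) ≠ 0) →
      MvPolynomial.eval v E ≠ 0 ∧ MvPolynomial.eval v Q = MvPolynomial.eval v E *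
        MvPolynomial.eval (fun t => MvPolynomial.eval v (m t) / MvPolynomial.eval v (e t)) p := by
  induction p using MvPolynomial.induction_on with
  | C a => exact ⟨MvPolynomial.C a, 1, fun v _ => by simp⟩
  | add p q hp hq =>
    obtain ⟨Q₁, E₁, h₁⟩ := hp
    obtain ⟨Q₂, E₂, h₂⟩ := hq
    refine ⟨E₂ * Q₁ + E₁ * Q₂, E₁ * E₂, fun v hv => ⟨?_, ?_⟩⟩
    · simpa using ⟨(h₁ v hv).1, (h₂ v hv).1⟩
    · simp only [map_add, map_mul, (h₁ v hv).2, (h₂ v hv).2]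
      ring
  | mul_X p t hp =>
    obtain ⟨Q, E, h⟩ := hp
    refine ⟨Q * m t, E * e t, fun v hv => ⟨?_, ?_⟩⟩
    · simpa using ⟨(h v hv).1, hv t⟩
    · simp only [map_mul, MvPolynomial.eval_X, (h v hv).2]
      field_simp [hv t]

/-- The polynomial with coefficients `y 0, …, y d` has degree `d` and, with multiplicities, the
roots `r 0, …, r (d - 1)`. -/
def HasRoots [DecidableEq K] {d : ℕ} (y : Fin (d + 1) → K) (r : Fin d → K) : Prop :=
  y (Fin.last d) ≠ 0 ∧ ofFn (d + 1) y = C (y (Fin.last d)) * ∏ i, (X - C (r i))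

variable [DecidableEq K] {d : ℕ}

lemma HasRoots.div_last {y : Fin (d + 1) → K} {r : Fin d → K} (h : HasRoots y r) (n : Fin d) :
    y n.castSucc / y (Fin.last d) = rootCoeff r n := by
  rw [div_eq_iff h.1, rootCoeff, mul_comm, ← coeff_C_mul, ← h.2,
    ofFn_coeff_eq_val_of_lt _ (n.2.trans d.lt_succ_self)]
  rfl

lemma exists_eval_ne_zero_of_hasRoots {P : MvPolynomial (κ × Fin d) K} {b : κ → K}
    (hP : MvPolynomial.eval (fun t => b t.1) P ≠ 0) :
    ∃ Q : MvPolynomial (κ × Fin (d + 1)) K,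
      (∀ y : κ → Fin (d + 1) → K, (∀ k, HasRoots (y k) fun _ => b k) →
        MvPolynomial.eval y.uncurry Q ≠ 0) ∧
      ∀ (y : κ → Fin (d + 1) → K) (r : κ → Fin d → K), (∀ k, HasRoots (y k) (r k)) →
        MvPolynomial.eval r.uncurry P = 0 → MvPolynomial.eval y.uncurry Q = 0 := by
  obtain ⟨P', hP', hvanish⟩ := exists_eval_rootCoeff_ne_zero hP
  obtain ⟨Q, E, hQ⟩ := exists_eval_eq_mul_eval_div
    (fun t : κ × Fin d => MvPolynomial.X (R := K) (t.1, t.2.castSucc))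
    (fun t => MvPolynomial.X (t.1, Fin.last d)) P'
  have key (y : κ → Fin (d + 1) → K) (r : κ → Fin d → K) (h : ∀ k, HasRoots (y k) (r k)) :
      MvPolynomial.eval y.uncurry E ≠ 0 ∧ MvPolynomial.eval y.uncurry Q =
        MvPolynomial.eval y.uncurry E *
          MvPolynomial.eval (Function.uncurry fun k => rootCoeff (r k)) P' := by
    have hquot : (Function.uncurry fun k => rootCoeff (r k)) = fun t : κ × Fin d =>
        y.uncurry (t.1, t.2.castSucc) / y.uncurry (t.1, Fin.last d) :=
      funext fun t => ((h t.1).div_last t.2).symm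
    simpa only [hquot, MvPolynomial.eval_X] using
      hQ y.uncurry fun t => (MvPolynomial.eval_X _).trans_ne (h t.1).1
  refine ⟨Q, fun y h => ?_, fun y r h hr => ?_⟩
  · rw [(key y _ h).2]
    exact mul_ne_zero (key y _ h).1 hP'
  · rw [(key y r h).2, hvanish r hr, mul_zero]

end ClearingDenominators

section Genericity

variable {σ τ : Type*}

lemma exists_eval_conj_ne_zero {P : MvPolynomial (τ ⊕ τ) ℂ} (hP : P ≠ 0) :
    ∃ u : τ → ℂ, MvPolynomial.eval (Sum.elim u (star u)) P ≠ 0 := by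
  by_contra! h
  let P₁ : MvPolynomial (τ ⊕ τ) ℂ := MvPolynomial.bind₁ (Sum.elim
    (fun t => MvPolynomial.X (Sum.inl t) + MvPolynomial.C Complex.I * MvPolynomial.X (Sum.inr t))
    (fun t => MvPolynomial.X (Sum.inl t) - MvPolynomial.C Complex.I * MvPolynomial.X (Sum.inr t))) P
  have hP₁ (a b : τ → ℂ) : MvPolynomial.eval (Sum.elim a b) P₁ = MvPolynomial.eval (Sum.elim
      (fun t => a t + Complex.I * b t) (fun t => a t - Complex.I * b t)) P := by
    rw [MvPolynomial.eval, MvPolynomial.eval₂Hom_bind₁]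
    congr 2
    funext t
    rcases t with t | t <;> simp
  have hzero : P₁ = 0 := by
    refine MvPolynomial.funext_set (fun _ => Set.range ((↑) : ℝ → ℂ))
      (fun _ => Set.infinite_range_of_injective Complex.ofReal_injective) fun v hv => ?_
    choose a ha using fun t => hv t (Set.mem_univ t)
    obtain rfl : (fun t => (a t : ℂ)) = v := funext ha
    rw [map_zero, ← Sum.elim_comp_inl_inr (fun t => (a t : ℂ)), hP₁,
      ← h fun t => a (Sum.inl t) + Complex.I * a (Sum.inr t)]
    congr 3
    funext t
    simp [sub_eq_add_neg]
  refine hP (MvPolynomial.funext fun v => ?_)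
  have hv := hP₁ (fun t => (v (Sum.inl t) + v (Sum.inr t)) / 2)
    (fun t => (v (Sum.inl t) - v (Sum.inr t)) / (2 * Complex.I))
  rw [hzero, map_zero] at hv
  rw [map_zero, hv]
  congr 2
  funext t
  rcases t with t | t <;> simp only [Sum.elim_inl, Sum.elim_inr] <;> field_simp <;> ring

lemma exists_eval_re_im_eq_eval_conj (Q : MvPolynomial (σ ⊕ σ) ℂ) :
    ∃ p q : MvPolynomial (σ ⊕ σ) ℝ, ∀ z : σ → ℂ, MvPolynomial.eval (Sum.elim z (star z)) Q =
      ⟨MvPolynomial.eval (Sum.elim (fun i => (z i).re) fun i => (z i).im) p,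
        MvPolynomial.eval (Sum.elim (fun i => (z i).re) fun i => (z i).im) q⟩ := by
  induction Q using MvPolynomial.induction_on with
  | C a => exact ⟨MvPolynomial.C a.re, MvPolynomial.C a.im, fun z => by simp⟩
  | add P P' hP hP' =>
    obtain ⟨p, q, h⟩ := hP
    obtain ⟨p', q', h'⟩ := hP'
    refine ⟨p + p', q + q', fun z => ?_⟩
    rw [map_add, h, h']
    apply Complex.ext <;> simp
  | mul_X P t hP =>
    obtain ⟨p, q, h⟩ := hP
    rcases t with i | i
    · refine ⟨p * MvPolynomial.X (Sum.inl i) - q * MvPolynomial.X (Sum.inr i),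
        p * MvPolynomial.X (Sum.inr i) + q * MvPolynomial.X (Sum.inl i), fun z => ?_⟩
      rw [map_mul, h]
      apply Complex.ext <;> simp
    · refine ⟨p * MvPolynomial.X (Sum.inl i) + q * MvPolynomial.X (Sum.inr i),
        q * MvPolynomial.X (Sum.inl i) - p * MvPolynomial.X (Sum.inr i), fun z => ?_⟩
      rw [map_mul, h]
      apply Complex.ext
      · simp
      · simp [neg_add_eq_sub]

lemma exists_eval_re_im_eq_normSq (Q : MvPolynomial (σ ⊕ σ) ℂ) :
    ∃ q : MvPolynomial (σ ⊕ σ) ℝ, ∀ z : σ → ℂ,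
      MvPolynomial.eval (Sum.elim (fun i => (z i).re) fun i => (z i).im) q =
        Complex.normSq (MvPolynomial.eval (Sum.elim z (star z)) Q) := by
  obtain ⟨p, q, h⟩ := exists_eval_re_im_eq_eval_conj Q
  exact ⟨p * p + q * q, fun z => by simp [h, Complex.normSq_mk]⟩

/-- The value at a complex point `u` of the real polynomial map with components `G`. -/
noncomputable def complexValue (G : σ → MvPolynomial τ ℝ) (u : τ → ℂ) (i : σ) : ℂ :=
  MvPolynomial.aeval u (G i)

lemma star_complexValue (G : σ → MvPolynomial τ ℝ) (u : τ → ℂ) :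
    star (complexValue G u) = complexValue G (star u) :=
  funext fun i => MvPolynomial.comp_aeval_apply u Complex.conjAe.toAlgHom (G i)

/-- The composition of a polynomial in two sets of variables with `G × G`, where `G` is a real
polynomial map. -/
noncomputable def pullback (G : σ → MvPolynomial τ ℝ) :
    MvPolynomial (σ ⊕ σ) ℂ →ₐ[ℂ] MvPolynomial (τ ⊕ τ) ℂ :=
  MvPolynomial.bind₁ (Sum.elim
    (fun i => MvPolynomial.rename Sum.inl (MvPolynomial.map (algebraMap ℝ ℂ) (G i)))
    (fun i => MvPolynomial.rename Sum.inr (MvPolynomial.map (algebraMap ℝ ℂ) (G i))))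

lemma eval_pullback (G : σ → MvPolynomial τ ℝ) (u v : τ → ℂ) (Q : MvPolynomial (σ ⊕ σ) ℂ) :
    MvPolynomial.eval (Sum.elim u v) (pullback G Q) =
      MvPolynomial.eval (Sum.elim (complexValue G u) (complexValue G v)) Q := by
  rw [pullback, MvPolynomial.eval, MvPolynomial.eval₂Hom_bind₁]
  congr 2
  funext t
  rcases t with i | i <;>
    simp [complexValue, MvPolynomial.aeval_def, MvPolynomial.eval₂_rename, MvPolynomial.eval₂_map]

/-- The property `P` holds wherever some polynomial `Q` in the coordinates and their conjugates does
not vanish. Here `Q`, with the conjugates read as independent variables, must not vanish identically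
on the square of the image of the polynomial map `G`. -/
def GenericAlong (G : σ → MvPolynomial τ ℝ) (P : (σ → ℂ) → Prop) : Prop :=
  ∃ Q : MvPolynomial (σ ⊕ σ) ℂ,
    (∃ u v : τ → ℂ,
      MvPolynomial.eval (Sum.elim (complexValue G u) (complexValue G v)) Q ≠ 0) ∧
    ∀ z : σ → ℂ, MvPolynomial.eval (Sum.elim z (star z)) Q ≠ 0 → P z

variable {G : σ → MvPolynomial τ ℝ}

lemma pullback_ne_zero {Q : MvPolynomial (σ ⊕ σ) ℂ} (h : ∃ u v : τ → ℂ,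
    MvPolynomial.eval (Sum.elim (complexValue G u) (complexValue G v)) Q ≠ 0) :
    pullback G Q ≠ 0 := by
  obtain ⟨u, v, huv⟩ := h
  rw [← eval_pullback] at huv
  exact fun h₀ => huv (by rw [h₀, map_zero])

lemma exists_eval_complexValue_conj_ne_zero {Q : MvPolynomial (σ ⊕ σ) ℂ} (hQ : pullback G Q ≠ 0) :
    ∃ u : τ → ℂ,
      MvPolynomial.eval (Sum.elim (complexValue G u) (star (complexValue G u))) Q ≠ 0 := by
  obtain ⟨u, hu⟩ := exists_eval_conj_ne_zero hQ
  exact ⟨u, by rwa [star_complexValue, ← eval_pullback]⟩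

lemma GenericAlong.and {P P' : (σ → ℂ) → Prop} (h : GenericAlong G P) (h' : GenericAlong G P') :
    GenericAlong G fun z => P z ∧ P' z := by
  obtain ⟨Q, hQ, hP⟩ := h
  obtain ⟨Q', hQ', hP'⟩ := h'
  obtain ⟨u, hu⟩ := exists_eval_complexValue_conj_ne_zero (G := G) (Q := Q * Q') <| by
    rw [map_mul]
    exact mul_ne_zero (pullback_ne_zero hQ) (pullback_ne_zero hQ')
  refine ⟨Q * Q', ⟨u, star u, by rwa [← star_complexValue]⟩, fun z hz => ?_⟩
  rw [map_mul] at hz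
  exact ⟨hP z (left_ne_zero_of_mul hz), hP' z (right_ne_zero_of_mul hz)⟩

lemma GenericAlong.forall_mem {ι : Type*} (s : Finset ι) {P : ι → (σ → ℂ) → Prop}
    (h : ∀ i ∈ s, GenericAlong G (P i)) : GenericAlong G fun z => ∀ i ∈ s, P i z := by
  classical
  induction s using Finset.induction_on with
  | empty => exact ⟨1, ⟨0, 0, by simp⟩, by simp⟩
  | insert i s _ ih =>
    simp only [Finset.forall_mem_insert] at h ⊢
    exact h.1.and (ih h.2)

lemma GenericAlong.exists_real_polynomial {P : (σ → ℂ) → Prop} (h : GenericAlong G P) :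
    ∃ q : MvPolynomial (σ ⊕ σ) ℝ,
      (∃ u : τ → ℂ, MvPolynomial.eval (Sum.elim (fun i => (complexValue G u i).re)
        fun i => (complexValue G u i).im) q ≠ 0) ∧
      ∀ z : σ → ℂ, MvPolynomial.eval (Sum.elim (fun i => (z i).re) fun i => (z i).im) q ≠ 0 →
        P z := by
  obtain ⟨Q, hQ, hP⟩ := h
  obtain ⟨q, hq⟩ := exists_eval_re_im_eq_normSq Q
  obtain ⟨u, hu⟩ := exists_eval_complexValue_conj_ne_zero (pullback_ne_zero hQ)
  refine ⟨q, ⟨u, ?_⟩, fun z hz => hP z ?_⟩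
  · rwa [hq, ne_eq, Complex.normSq_eq_zero]
  · rwa [hq, ne_eq, Complex.normSq_eq_zero] at hz

end Genericity

section TripleVariety

variable {N W α : ℕ}

/-- The positions `0, α, -α` of the three windows. -/
def windowShift (α : ℕ) : Fin 3 → ℤ := ![0, α, -α]

variable (N W α) in
/-- The components of `tripleMap` as polynomials in the entries of the signal (`Sum.inl`) and of the
window (`Sum.inr`). -/
noncomputable def tripleParam (t : Fin 3 × Fin W) : MvPolynomial (ZMod N ⊕ Fin W) ℝ :=
  MvPolynomial.X (Sum.inl ((windowShift α t.1 - (t.2 : ℕ) : ℤ) : ZMod N)) *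
    MvPolynomial.X (Sum.inr t.2)

lemma complexValue_tripleParam (u : ZMod N ⊕ Fin W → ℂ) (t : Fin 3 × Fin W) :
    complexValue (tripleParam N W α) u t =
      u (Sum.inl ((windowShift α t.1 - (t.2 : ℕ) : ℤ) : ZMod N)) * u (Sum.inr t.2) := by
  simp [complexValue, tripleParam]

lemma curry_complexValue_tripleParam_mem (u : ZMod N ⊕ Fin W → ℂ) :
    Function.curry (complexValue (tripleParam N W α) u) ∈ tripleVariety N W α := by
  refine subset_closure ⟨(u ∘ Sum.inl, u ∘ Sum.inr), ?_⟩
  funext j n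
  rw [Function.curry, complexValue_tripleParam]
  fin_cases j <;> rfl

lemma GenericAlong.holdsGenerically {P : (Fin 3 × Fin W → ℂ) → Prop}
    {P' : (Fin 3 → Fin W → ℂ) → Prop} (h : GenericAlong (tripleParam N W α) P)
    (hPP' : ∀ z ∈ tripleVariety N W α, P z.uncurry → P' z) :
    HoldsGenerically (tripleVariety N W α) P' := by
  obtain ⟨q, ⟨u, hu⟩, hq⟩ := h.exists_real_polynomial
  exact ⟨q, ⟨_, curry_complexValue_tripleParam_mem u, hu⟩, fun z hz hqz => hPP' z hz (hq _ hqz)⟩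

end TripleVariety

section RootExchange

lemma natDegree_ofFn_of_last_ne_zero {R : Type*} [Semiring R] [DecidableEq R] {d : ℕ}
    {y : Fin (d + 1) → R} (hy : y (Fin.last d) ≠ 0) : (ofFn (d + 1) y).natDegree = d := by
  refine le_antisymm (Nat.lt_succ_iff.1 (ofFn_natDegree_lt le_add_self y))
    (le_natDegree_of_ne_zero ?_)
  rwa [ofFn_coeff_eq_val_of_lt _ d.lt_succ_self]

lemma ofFn_ne_zero_of_apply_ne_zero {R : Type*} [Semiring R] [DecidableEq R] {d : ℕ}
    {y : Fin d → R} {n : Fin d} (hy : y n ≠ 0) : ofFn d y ≠ 0 :=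
  fun h => hy (congrFun ((map_eq_zero_iff _ (injective_ofFn d)).1 h) n)

/-- The product of the linear factors `X - r i` with `i < l`. -/
noncomputable def firstFactors {R : Type*} [CommRing R] {d : ℕ} (l : ℕ) (r : Fin d → R) : R[X] :=
  ∏ i ∈ {i : Fin d | (i : ℕ) < l}, (X - C (r i))

lemma firstFactors_zero {R : Type*} [CommRing R] {d : ℕ} (r : Fin d → R) :
    firstFactors 0 r = 1 := by
  simp [firstFactors]

lemma firstFactors_self {R : Type*} [CommRing R] {d : ℕ} (r : Fin d → R) :
    firstFactors d r = ∏ i, (X - C (r i)) := by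
  simp [firstFactors]

lemma firstFactors_const {R : Type*} [CommRing R] {d l : ℕ} (hl : l ≤ d) (a : R) :
    firstFactors l (fun _ : Fin d => a) = (X - C a) ^ l := by
  rw [firstFactors, Finset.prod_const, Fin.card_filter_val_lt, min_eq_right hl]

lemma firstFactors_append {R : Type*} [CommRing R] {l k : ℕ} (r : Fin l → R) (s : Fin k → R) :
    firstFactors l (Fin.append r s) = ∏ i, (X - C (r i)) := by
  simp [firstFactors, Finset.prod_filter, Fin.prod_univ_add]

lemma map_firstFactors {R S : Type*} [CommRing R] [CommRing S] (φ : R →+* S) {d : ℕ} (l : ℕ)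
    (r : Fin d → R) : (firstFactors l r).map φ = firstFactors l (φ ∘ r) := by
  simp [firstFactors, Polynomial.map_prod]

section IsAlgClosed

variable {K : Type*} [Field K] [IsAlgClosed K]

lemma exists_eq_C_mul_prod_X_sub_C (p : K[X]) :
    ∃ r : Fin p.natDegree → K, p = C p.leadingCoeff * ∏ i, (X - C (r i)) := by
  have hp := IsAlgClosed.splits p
  obtain ⟨r, hr⟩ : ∃ r : Fin p.natDegree → K, Finset.univ.val.map r = p.roots := by
    rw [hp.natDegree_eq_card_roots]
    induction p.roots using Quotient.inductionOn with
    | h L =>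
      refine ⟨L.get, ?_⟩
      change Finset.univ.val.map L.get = (L : Multiset K)
      rw [Fin.univ_val_map, List.ofFn_get]
  refine ⟨r, ?_⟩
  conv_lhs => rw [hp.eq_prod_roots, ← hr, Multiset.map_map]
  rfl

lemma exists_hasRoots_of_ofFn_eq_mul [DecidableEq K] {d : ℕ} {y : Fin (d + 1) → K}
    (hy : y (Fin.last d) ≠ 0) {p q : K[X]} (h : ofFn (d + 1) y = p * q) :
    ∃ r : Fin d → K, HasRoots y r ∧ p = C p.leadingCoeff * firstFactors p.natDegree r := by
  have hpq : p * q ≠ 0 := h ▸ ofFn_ne_zero_of_apply_ne_zero hy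
  have hd : d = p.natDegree + q.natDegree := by
    rw [← natDegree_mul (left_ne_zero_of_mul hpq) (right_ne_zero_of_mul hpq), ← h,
      natDegree_ofFn_of_last_ne_zero hy]
  obtain ⟨r, hr⟩ := exists_eq_C_mul_prod_X_sub_C p
  obtain ⟨s, hs⟩ := exists_eq_C_mul_prod_X_sub_C q
  have hlead : y (Fin.last d) = p.leadingCoeff * q.leadingCoeff := by
    rw [← leadingCoeff_mul, ← h, leadingCoeff, natDegree_ofFn_of_last_ne_zero hy,
      ofFn_coeff_eq_val_of_lt _ d.lt_succ_self]
    rfl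
  subst hd
  refine ⟨Fin.append r s, ⟨hy, ?_⟩, by rwa [firstFactors_append]⟩
  rw [h, hlead, Fin.prod_univ_add, C_mul]
  simp only [Fin.append_left, Fin.append_right]
  rw [mul_mul_mul_comm, ← hr, ← hs]

end IsAlgClosed

variable {d : ℕ}

/-- The conjugates of the entries of `y`, in reverse order: on the unit circle, the polynomial with
these coefficients is `ω ^ d` times the conjugate of the polynomial with coefficients `y`. -/
noncomputable def conjRev (y : Fin (d + 1) → ℂ) : Fin (d + 1) → ℂ :=
  fun n => star (y n.rev)

lemma eval_ofFn (y : Fin (d + 1) → ℂ) (a : ℂ) :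
    (ofFn (d + 1) y).eval a = ∑ n, y n * a ^ (n : ℕ) := by
  simp [ofFn_eq_sum_monomial, eval_finsetSum]

lemma eval_ofFn_conjRev (y : Fin (d + 1) → ℂ) (ω : Circle) :
    (ofFn (d + 1) (conjRev y)).eval (ω : ℂ) = ω ^ d * star ((ofFn (d + 1) y).eval (ω : ℂ)) := by
  rw [eval_ofFn, eval_ofFn, star_sum, Finset.mul_sum, ← Equiv.sum_comp Fin.revPerm]
  refine Finset.sum_congr rfl fun n _ => ?_
  have hω : (ω : ℂ) * star (ω : ℂ) = 1 := by
    rw [Complex.star_def, Complex.mul_conj, Circle.normSq_coe, Complex.ofReal_one]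
  have hpow : (ω : ℂ) ^ d = ω ^ (n.rev : ℕ) * ω ^ (n : ℕ) := by
    rw [← pow_add, Fin.val_rev]
    congr 1
    omega
  rw [Fin.revPerm_apply, conjRev, Fin.rev_rev, star_mul', star_pow, hpow]
  have hωn : (ω : ℂ) ^ (n : ℕ) * star (ω : ℂ) ^ (n : ℕ) = 1 := by rw [← mul_pow, hω, one_pow]
  linear_combination -(star (y n) * (ω : ℂ) ^ (n.rev : ℕ)) * hωn

lemma infinite_range_circle_coe : (Set.range ((↑) : Circle → ℂ)).Infinite := by
  have : Infinite (Set.Ioc (-Real.pi) Real.pi) :=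
    (Set.Ioc_infinite (neg_lt_self Real.pi_pos)).to_subtype
  have : Infinite Circle := Infinite.of_injective _ Circle.argEquiv.symm.injective
  exact Set.infinite_range_of_injective (α := Circle) Circle.coe_injective

lemma ofFn_mul_ofFn_conjRev_eq {y y' : Fin (d + 1) → ℂ}
    (h : fourierIntensity y' = fourierIntensity y) :
    ofFn (d + 1) y' * ofFn (d + 1) (conjRev y') = ofFn (d + 1) y * ofFn (d + 1) (conjRev y) := by
  have heval (v : Fin (d + 1) → ℂ) (ω : Circle) :
      (ofFn (d + 1) v * ofFn (d + 1) (conjRev v)).eval (ω : ℂ) =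
        ω ^ d * (fourierIntensity v ω : ℂ) := by
    rw [eval_mul, eval_ofFn_conjRev, mul_left_comm, Complex.star_def, Complex.mul_conj', eval_ofFn]
    simp [fourierIntensity]
  refine eq_of_infinite_eval_eq _ _ (infinite_range_circle_coe.mono ?_)
  rintro _ ⟨ω, rfl⟩
  exact (heval y' ω).trans (h ▸ (heval y ω).symm)

/-- Up to a scalar, the roots of `y'` are `l` of the `d` roots of `y` together with `d - l` of the
roots of `conjRev y`. -/
def IsRootExchange (l : ℕ) (y y' : Fin (d + 1) → ℂ) : Prop :=
  ∃ (r s : Fin d → ℂ) (c : ℂ), HasRoots y r ∧ HasRoots (conjRev y) s ∧ c ≠ 0 ∧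
    ofFn (d + 1) y' = C c * (firstFactors l r * firstFactors (d - l) s)

variable {y y' : Fin (d + 1) → ℂ}

lemma exists_isRootExchange (h : fourierIntensity y' = fourierIntensity y) (h₀ : y 0 ≠ 0)
    (hd : y (Fin.last d) ≠ 0) : ∃ l : Fin (d + 1), IsRootExchange l y y' := by
  have hprod := ofFn_mul_ofFn_conjRev_eq h
  have hd' : y' (Fin.last d) ≠ 0 := by
    intro hy'
    have hcoeff : y' 0 * star (y' (Fin.last d)) = y 0 * star (y (Fin.last d)) := by
      simpa [conjRev, mul_coeff_zero, ofFn_coeff_eq_val_of_lt _ d.succ_pos]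
        using congrArg (coeff · 0) hprod
    simp [hy', h₀, hd] at hcoeff
  obtain ⟨p, q, ⟨p', hp⟩, ⟨q', hq⟩, hpq⟩ :=
    exists_dvd_and_dvd_of_dvd_mul (hprod ▸ dvd_mul_right _ _ : ofFn (d + 1) y' ∣ _)
  obtain ⟨r, hyr, hr⟩ := exists_hasRoots_of_ofFn_eq_mul hd hp
  obtain ⟨s, hys, hs⟩ := exists_hasRoots_of_ofFn_eq_mul (y := conjRev y) (by simpa [conjRev]) hq
  have hpq₀ : p * q ≠ 0 := hpq ▸ ofFn_ne_zero_of_apply_ne_zero hd'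
  have hdeg : d = p.natDegree + q.natDegree := by
    rw [← natDegree_mul (left_ne_zero_of_mul hpq₀) (right_ne_zero_of_mul hpq₀), ← hpq,
      natDegree_ofFn_of_last_ne_zero hd']
  refine ⟨⟨p.natDegree, by omega⟩, r, s, p.leadingCoeff * q.leadingCoeff, hyr, hys, ?_, ?_⟩
  · rwa [← leadingCoeff_mul, leadingCoeff_ne_zero]
  · rw [show d - p.natDegree = q.natDegree by omega, C_mul, mul_mul_mul_comm, ← hr, ← hs, hpq]

lemma IsRootExchange.exists_eq_smul (h : IsRootExchange d y y') : ∃ a : ℂ, y' = a • y := by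
  obtain ⟨r, s, c, ⟨hy, hr⟩, -, -, h⟩ := h
  refine ⟨c / y (Fin.last d), injective_ofFn _ ?_⟩
  rw [h, Nat.sub_self, firstFactors_zero, firstFactors_self, mul_one, map_smul, hr, smul_eq_C_mul,
    ← mul_assoc, ← C_mul, div_mul_cancel₀ _ hy]

lemma IsRootExchange.exists_eq_smul_conjRev (h : IsRootExchange 0 y y') :
    ∃ a : ℂ, a ≠ 0 ∧ y' = a • conjRev y := by
  obtain ⟨r, s, c, -, ⟨hy, hs⟩, hc, h⟩ := h
  refine ⟨c / conjRev y (Fin.last d), div_ne_zero hc hy, injective_ofFn _ ?_⟩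
  rw [h, Nat.sub_zero, firstFactors_zero, firstFactors_self, one_mul, map_smul, hs, smul_eq_C_mul,
    ← mul_assoc, ← C_mul, div_mul_cancel₀ _ hy]

lemma norm_eq_one_of_fourierIntensity_smul_eq {a : ℂ} (hy : y ≠ 0)
    (h : fourierIntensity (a • y) = fourierIntensity y) : ‖a‖ = 1 := by
  have hprod := ofFn_mul_ofFn_conjRev_eq h
  have hconj : conjRev (a • y) = star a • conjRev y := funext fun n => star_mul' _ _
  have hne : ofFn (d + 1) y * ofFn (d + 1) (conjRev y) ≠ 0 := by
    obtain ⟨n, hn⟩ := Function.ne_iff.1 hy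
    refine mul_ne_zero (ofFn_ne_zero_of_apply_ne_zero hn)
      (ofFn_ne_zero_of_apply_ne_zero (n := n.rev) ?_)
    simpa [conjRev] using hn
  rw [hconj, map_smul, map_smul, smul_mul_smul_comm] at hprod
  have ha : a * star a = 1 := (smul_left_injective ℂ hne) (hprod.trans (one_smul _ _).symm)
  rw [Complex.star_def, Complex.mul_conj'] at ha
  exact (pow_eq_one_iff_of_nonneg (norm_nonneg a) two_ne_zero).1 (mod_cast ha)

end RootExchange

section BinomialRelations

/-- The identities `z₀[n] z₀[n + α] = z₋[n] z₊[n + α]` (with `z₊ = z 1`, `z₋ = z 2`) satisfied by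
the triples of windowed sections: both sides are `x[-n] x[-n - α] w[n] w[n + α]`. -/
def BinomialRelations {W : ℕ} (α : ℕ) (z : Fin 3 → Fin W → ℂ) : Prop :=
  ∀ n m : Fin W, (m : ℕ) = α + n → z 0 n * z 0 m = z 2 n * z 1 m

lemma binomialRelations_of_mem {N W α : ℕ} {z : Fin 3 → Fin W → ℂ}
    (hz : z ∈ tripleVariety N W α) : BinomialRelations α z := by
  intro n m hnm
  have hc : IsClosed {z : Fin 3 → Fin W → ℂ | z 0 n * z 0 m = z 2 n * z 1 m} :=
    isClosed_eq (by fun_prop) (by fun_prop)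
  refine closure_minimal ?_ hc hz
  rintro _ ⟨⟨x, w⟩, rfl⟩
  change x _ * w n * (x _ * w m) = x _ * w n * (x _ * w m)
  rw [show -(α : ℤ) - (n : ℕ) = 0 - (m : ℕ) by rw [hnm]; push_cast; ring,
    show (α : ℤ) - (m : ℕ) = 0 - (n : ℕ) by rw [hnm]; push_cast; ring]
  ring

/-- The determinant of the binomial relations at `i` and `i + 1`, for three sequences known only up
to scalars. -/
def shiftMinor {R : Type*} [CommRing R] (α i : ℕ) (f : Fin 3 → ℕ → R) : R :=
  f 0 i * f 0 (α + i) * (f 2 (i + 1) * f 1 (α + (i + 1))) -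
    f 0 (i + 1) * f 0 (α + (i + 1)) * (f 2 i * f 1 (α + i))

lemma map_shiftMinor {R S : Type*} [CommRing R] [CommRing S] (φ : R →+* S) (α i : ℕ)
    (f : Fin 3 → ℕ → R) : φ (shiftMinor α i f) = shiftMinor α i fun j n => φ (f j n) := by
  simp only [shiftMinor, map_sub, map_mul]

lemma BinomialRelations.shiftMinor_eq_zero {d α i : ℕ} {z : Fin 3 → Fin (d + 1) → ℂ}
    (hz : BinomialRelations α z) (hi : α + i < d) {f : Fin 3 → ℕ → ℂ} {c : Fin 3 → ℂ}
    (hc : ∀ j, c j ≠ 0) (hf : ∀ j (n : Fin (d + 1)), z j n = c j * f j n) :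
    shiftMinor α i f = 0 := by
  have h₁ := hz ⟨i, by omega⟩ ⟨α + i, by omega⟩ rfl
  have h₂ := hz ⟨i + 1, by omega⟩ ⟨α + (i + 1), by omega⟩ rfl
  simp only [hf] at h₁ h₂
  refine (mul_eq_zero.1 ?_).resolve_left
    (mul_ne_zero (pow_ne_zero 2 (hc 0)) (mul_ne_zero (hc 1) (hc 2)))
  rw [shiftMinor]
  linear_combination
    c 2 * f 2 (i + 1) * (c 1 * f 1 (α + (i + 1))) * h₁ - c 2 * f 2 i * (c 1 * f 1 (α + i)) * h₂

lemma apply_shiftMinor_terms_eq {R M : Type*} [CommRing R] [IsDomain R] {α i d : ℕ}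
    (hi : α + i < d) {f : Fin 3 → ℕ → R} (hf : ∀ j, ∀ n ≤ d, f j n ≠ 0)
    (h : shiftMinor α i f = 0) {v : R → M} {op : M → M → M}
    (hv : ∀ a b, a ≠ 0 → b ≠ 0 → v (a * b) = op (v a) (v b)) :
    op (op (v (f 0 i)) (v (f 0 (α + i)))) (op (v (f 2 (i + 1))) (v (f 1 (α + (i + 1))))) =
      op (op (v (f 0 (i + 1))) (v (f 0 (α + (i + 1))))) (op (v (f 2 i)) (v (f 1 (α + i)))) := by
  have h₀ (j) : f j i ≠ 0 := hf j _ (by omega)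
  have h₁ (j) : f j (i + 1) ≠ 0 := hf j _ (by omega)
  have h₂ (j) : f j (α + i) ≠ 0 := hf j _ (by omega)
  have h₃ (j) : f j (α + (i + 1)) ≠ 0 := hf j _ (by omega)
  rw [← hv _ _ (h₀ 0) (h₂ 0), ← hv _ _ (h₁ 2) (h₃ 1), ← hv _ _ (h₁ 0) (h₃ 0),
    ← hv _ _ (h₀ 2) (h₂ 1), ← hv _ _ (mul_ne_zero (h₀ 0) (h₂ 0)) (mul_ne_zero (h₁ 2) (h₃ 1)),
    ← hv _ _ (mul_ne_zero (h₁ 0) (h₃ 0)) (mul_ne_zero (h₀ 2) (h₂ 1)), sub_eq_zero.1 h]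

end BinomialRelations

section TwoRoots

variable {R : Type*} [CommRing R]

/-- The coefficient of `X ^ n` in `(X + ε) ^ l * (X + η) ^ k`, as a polynomial in `ε`. -/
noncomputable def twoRootCoeff (l k : ℕ) (η : R) (n : ℕ) : R[X] :=
  ((X + C X) ^ l * (X + C (C η)) ^ k : R[X][X]).coeff n

lemma eval_twoRootCoeff (l k : ℕ) (η : R) (n : ℕ) (ε : R) :
    (twoRootCoeff l k η n).eval ε = ((X + C ε) ^ l * (X + C η) ^ k).coeff n := by
  rw [twoRootCoeff, ← coe_evalRingHom, ← coeff_map]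
  simp

lemma coeff_twoRootCoeff (l k : ℕ) (η : R) (n e : ℕ) :
    (twoRootCoeff l k η n).coeff e = if e ≤ l ∧ l ≤ n + e then
      (l.choose e : R) * k.choose (n + e - l) * η ^ (k - (n + e - l)) else 0 := by
  have hterm (m : ℕ) : C X ^ m * X ^ (l - m) * (l.choose m : R[X][X]) * (X + C (C η)) ^ k =
      C (monomial m (l.choose m : R)) * ((X + C η) ^ k * X ^ (l - m)).map C := by
    simp only [← C_mul_X_pow_eq_monomial, Polynomial.map_mul, Polynomial.map_pow,
      Polynomial.map_add, map_X, map_C, C_mul, C_pow, map_natCast]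
    ring
  rw [twoRootCoeff, add_comm X (C X), add_pow, Finset.sum_mul, finsetSum_coeff, finsetSum_coeff]
  simp only [hterm, coeff_C_mul, coeff_map, coeff_mul_C, coeff_monomial, ite_mul, zero_mul,
    Finset.sum_ite_eq', Finset.mem_range, coeff_mul_X_pow', coeff_X_add_C_pow]
  by_cases h : e ≤ l ∧ l ≤ n + e
  · rw [if_pos (by omega), if_pos (by omega), if_pos h, show n - (l - e) = n + e - l by omega]
    ring
  · rw [if_neg h, ite_eq_right_iff]
    intro he
    rw [if_neg (by omega), mul_zero]

variable [IsDomain R] [CharZero R] {l k : ℕ} {η : R}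

lemma coeff_twoRootCoeff_ne_zero (hη : η ≠ 0) {n e : ℕ} (he : e ≤ l) (hl : l ≤ n + e)
    (hn : n + e ≤ l + k) : (twoRootCoeff l k η n).coeff e ≠ 0 := by
  rw [coeff_twoRootCoeff, if_pos ⟨he, hl⟩]
  have hle := (Nat.choose_pos he).ne'
  have hk := (Nat.choose_pos (show n + e - l ≤ k by omega)).ne'
  exact mul_ne_zero (mul_ne_zero (mod_cast hle) (mod_cast hk)) (pow_ne_zero _ hη)

lemma twoRootCoeff_ne_zero (hη : η ≠ 0) {n : ℕ} (hn : n ≤ l + k) : twoRootCoeff l k η n ≠ 0 :=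
  fun h => coeff_twoRootCoeff_ne_zero (e := l - n) hη (by omega) (by omega) (by omega)
    (h ▸ coeff_zero _ : (twoRootCoeff l k η n).coeff (l - n) = 0)

lemma natTrailingDegree_twoRootCoeff (hη : η ≠ 0) {n : ℕ} (hn : n ≤ l + k) :
    (twoRootCoeff l k η n).natTrailingDegree = l - n := by
  refine le_antisymm (natTrailingDegree_le_of_ne_zero
    (coeff_twoRootCoeff_ne_zero hη (by omega) (by omega) (by omega)))
    (le_natTrailingDegree (twoRootCoeff_ne_zero hη hn) fun m hm => ?_)
  rw [coeff_twoRootCoeff, if_neg (by omega)]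

lemma natDegree_twoRootCoeff (hη : η ≠ 0) {n : ℕ} (hn : n ≤ l + k) :
    (twoRootCoeff l k η n).natDegree = min l (l + k - n) := by
  refine le_antisymm (natDegree_le_iff_coeff_eq_zero.2 fun m hm => ?_) (le_natDegree_of_ne_zero
    (coeff_twoRootCoeff_ne_zero hη (by omega) (by omega) (by omega)))
  rw [coeff_twoRootCoeff, ite_eq_right_iff]
  intro h
  rw [Nat.choose_eq_zero_of_lt (by omega : k < n + m - l), Nat.cast_zero, mul_zero, zero_mul]

lemma trailingCoeff_twoRootCoeff_div_norm {η : ℂ} (hη : ‖η‖ = 1) {n : ℕ} (hn : n ≤ l + k) :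
    (twoRootCoeff l k η n).trailingCoeff / ‖(twoRootCoeff l k η n).trailingCoeff‖ =
      η ^ (k - (n - l)) := by
  have hη₀ : η ≠ 0 := norm_ne_zero_iff.1 (hη ▸ one_ne_zero)
  have hle := (Nat.choose_pos (show l - n ≤ l by omega)).ne'
  have hk := (Nat.choose_pos (show n - l ≤ k by omega)).ne'
  rw [trailingCoeff, natTrailingDegree_twoRootCoeff hη₀ hn, coeff_twoRootCoeff,
    if_pos (by omega), show n + (l - n) - l = n - l by omega]
  simp only [norm_mul, norm_pow, hη, one_pow, Complex.norm_natCast]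
  push_cast
  field_simp

end TwoRoots

section TwoRootMinor

variable {d α i : ℕ} {l k : Fin 3 → ℕ}

lemma natTrailingDegree_balance {R : Type*} [CommRing R] [IsDomain R] [CharZero R]
    {η : Fin 3 → R} (hη : ∀ j, η j ≠ 0) (hlk : ∀ j, l j + k j = d) (hi : α + i < d)
    (h : shiftMinor α i (fun j => twoRootCoeff (l j) (k j) (η j)) = 0) :
    l 0 - i + (l 0 - (α + i)) + (l 2 - (i + 1) + (l 1 - (α + (i + 1)))) =
      l 0 - (i + 1) + (l 0 - (α + (i + 1))) + (l 2 - i + (l 1 - (α + i))) := by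
  have hv (j n) (hn : n ≤ d) : (twoRootCoeff (l j) (k j) (η j) n).natTrailingDegree = l j - n :=
    natTrailingDegree_twoRootCoeff (hη j) (hn.trans_eq (hlk j).symm)
  have hterms := apply_shiftMinor_terms_eq hi
    (fun j n hn => twoRootCoeff_ne_zero (hη j) (hn.trans_eq (hlk j).symm)) h
    (op := (· + ·)) fun _ _ => natTrailingDegree_mul
  simpa (disch := omega) only [hv] using hterms

lemma natDegree_balance {R : Type*} [CommRing R] [IsDomain R] [CharZero R]
    {η : Fin 3 → R} (hη : ∀ j, η j ≠ 0) (hlk : ∀ j, l j + k j = d) (hi : α + i < d)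
    (h : shiftMinor α i (fun j => twoRootCoeff (l j) (k j) (η j)) = 0) :
    min (l 0) (d - i) + min (l 0) (d - (α + i)) +
        (min (l 2) (d - (i + 1)) + min (l 1) (d - (α + (i + 1)))) =
      min (l 0) (d - (i + 1)) + min (l 0) (d - (α + (i + 1))) +
        (min (l 2) (d - i) + min (l 1) (d - (α + i))) := by
  have hv (j n) (hn : n ≤ d) :
      (twoRootCoeff (l j) (k j) (η j) n).natDegree = min (l j) (d - n) := by
    rw [natDegree_twoRootCoeff (hη j) (hn.trans_eq (hlk j).symm), hlk]
  have hterms := apply_shiftMinor_terms_eq hi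
    (fun j n hn => twoRootCoeff_ne_zero (hη j) (hn.trans_eq (hlk j).symm)) h
    (op := (· + ·)) fun _ _ => natDegree_mul
  simpa (disch := omega) only [hv] using hterms

lemma trailingPhase_balance {η : Fin 3 → ℂ} (hη : ∀ j, ‖η j‖ = 1) (hlk : ∀ j, l j + k j = d)
    (hi : α + i < d) (h : shiftMinor α i (fun j => twoRootCoeff (l j) (k j) (η j)) = 0) :
    η 0 ^ (k 0 - (i - l 0)) * η 0 ^ (k 0 - (α + i - l 0)) *
        (η 2 ^ (k 2 - (i + 1 - l 2)) * η 1 ^ (k 1 - (α + (i + 1) - l 1))) =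
      η 0 ^ (k 0 - (i + 1 - l 0)) * η 0 ^ (k 0 - (α + (i + 1) - l 0)) *
        (η 2 ^ (k 2 - (i - l 2)) * η 1 ^ (k 1 - (α + i - l 1))) := by
  have hη₀ (j) : η j ≠ 0 := norm_ne_zero_iff.1 (hη j ▸ one_ne_zero)
  have hterms := apply_shiftMinor_terms_eq hi
    (fun j n hn => twoRootCoeff_ne_zero (hη₀ j) (hn.trans_eq (hlk j).symm)) h
    (v := fun p => p.trailingCoeff / (‖p.trailingCoeff‖ : ℂ)) (op := (· * ·)) fun a b _ _ => by
      rw [trailingCoeff_mul, norm_mul, Complex.ofReal_mul, mul_div_mul_comm]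
  have hv (j n) (hn : n ≤ d) : (twoRootCoeff (l j) (k j) (η j) n).trailingCoeff /
      (‖(twoRootCoeff (l j) (k j) (η j) n).trailingCoeff‖ : ℂ) = η j ^ (k j - (n - l j)) :=
    trailingCoeff_twoRootCoeff_div_norm (hη j) (hn.trans_eq (hlk j).symm)
  simpa (disch := omega) only [hv] using hterms

lemma eq_zero_of_shiftMinor_twoRootCoeff_eq_zero {R : Type*} [CommRing R] [IsDomain R]
    [CharZero R] {η : Fin 3 → R} (hα : 0 < α) (hd : α < d) (hη : ∀ j, η j ≠ 0)
    (hlk : ∀ j, l j + k j = d)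
    (h : ∀ i, α + i < d → shiftMinor α i (fun j => twoRootCoeff (l j) (k j) (η j)) = 0)
    (hl₀ : l 0 = 0) (j : Fin 3) : l j = 0 := by
  obtain ⟨i, rfl⟩ : ∃ i, d = α + i + 1 := ⟨d - α - 1, by omega⟩
  have hfirst := natTrailingDegree_balance hη hlk (i := 0) hd (h 0 hd)
  have hlast := natDegree_balance hη hlk (Nat.lt_succ_self _) (h i (Nat.lt_succ_self _))
  simp only [hl₀, zero_tsub, Nat.zero_min, zero_add] at hfirst hlast
  have hl₂ : l 2 = 0 := by omega
  have hl₁ : l 1 = 0 := by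
    rw [hl₂] at hlast
    omega
  fin_cases j <;> assumption

lemma eq_of_shiftMinor_twoRootCoeff_eq_zero {R : Type*} [CommRing R] [IsDomain R]
    [CharZero R] {η : Fin 3 → R} (hα : 0 < α) (hd : α < d) (hη : ∀ j, η j ≠ 0)
    (hlk : ∀ j, l j + k j = d)
    (h : ∀ i, α + i < d → shiftMinor α i (fun j => twoRootCoeff (l j) (k j) (η j)) = 0)
    (hl₀ : l 0 = d) (j : Fin 3) : l j = d := by
  obtain ⟨i, rfl⟩ : ∃ i, d = α + i + 1 := ⟨d - α - 1, by omega⟩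
  have hfirst := natDegree_balance hη hlk (i := 0) hd (h 0 hd)
  have hlast := natTrailingDegree_balance hη hlk (Nat.lt_succ_self _) (h i (Nat.lt_succ_self _))
  have hlk₁ := hlk 1
  have hlk₂ := hlk 2
  rw [hl₀] at hfirst hlast
  have hl₂ : l 2 = α + i + 1 := by
    clear hlast
    omega
  have hl₁ : l 1 = α + i + 1 := by
    rw [hl₂] at hlast
    clear hfirst
    omega
  fin_cases j <;> assumption

lemma exists_shiftMinor_twoRootCoeff_ne_zero_of_first_mem_Ioo (hα : 0 < α) (hd : α < d)
    {η : Fin 3 → ℂ} (hη : ∀ j, ‖η j‖ = 1) (hη₀ : η 0 = 1) (hη₁ : η 1 ≠ 1) (hη₂ : η 2 ≠ 1)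
    (hlk : ∀ j, l j + k j = d) (hl₀ : 0 < l 0) (hk₀ : 0 < k 0) :
    ∃ i, α + i < d ∧ shiftMinor α i (fun j => twoRootCoeff (l j) (k j) (η j)) ≠ 0 := by
  have hlk₀ := hlk 0
  have hlk₁ := hlk 1
  have hlk₂ := hlk 2
  have hη' (j) : η j ≠ 0 := norm_ne_zero_iff.1 (hη j ▸ one_ne_zero)
  obtain ⟨i, hi, hil, hli⟩ : ∃ i, α + i < d ∧ i + 1 ≤ l 0 ∧ l 0 < α + i + 1 := by
    rcases le_total (l 0) (d - α) with h | h
    · exact ⟨l 0 - 1, by omega⟩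
    · exact ⟨d - α - 1, by omega⟩
  -- The orders in `ε` balance only if exactly one of `i < l 2` and `α + i < l 1` holds; the phases
  -- of the lowest terms then differ by the factor `η 2` or `η 1`.
  refine ⟨i, hi, fun h => ?_⟩
  have hdeg := natTrailingDegree_balance hη' hlk hi h
  have hphase := trailingPhase_balance hη hlk hi h
  simp only [hη₀, one_pow, one_mul] at hphase
  rcases lt_or_ge (l 2) (i + 1) with hl | hl
  · rw [show k 1 - (α + (i + 1) - l 1) = k 1 - (α + i - l 1) by omega,
      show k 2 - (i - l 2) = k 2 - (i + 1 - l 2) + 1 by omega] at hphase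
    have hpow := mul_right_cancel₀ (pow_ne_zero _ (hη' 1)) hphase
    exact hη₂ (mul_left_cancel₀ (pow_ne_zero _ (hη' 2)) (by rw [mul_one, ← pow_succ, ← hpow]))
  · rw [show k 2 - (i + 1 - l 2) = k 2 - (i - l 2) by omega,
      show k 1 - (α + i - l 1) = k 1 - (α + (i + 1) - l 1) + 1 by omega] at hphase
    have hpow := mul_left_cancel₀ (pow_ne_zero _ (hη' 2)) hphase
    exact hη₁ (mul_left_cancel₀ (pow_ne_zero _ (hη' 1)) (by rw [mul_one, ← pow_succ, ← hpow]))

lemma exists_shiftMinor_twoRootCoeff_ne_zero (hα : 0 < α) (hd : α < d) {η : Fin 3 → ℂ}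
    (hη : ∀ j, ‖η j‖ = 1) (hη₀ : η 0 = 1) (hη₁ : η 1 ≠ 1) (hη₂ : η 2 ≠ 1)
    (hlk : ∀ j, l j + k j = d) (hl : ∃ j, l j ≠ 0) (hk : ∃ j, k j ≠ 0) :
    ∃ i, α + i < d ∧ shiftMinor α i (fun j => twoRootCoeff (l j) (k j) (η j)) ≠ 0 := by
  obtain ⟨j, hj⟩ := hl
  obtain ⟨j', hj'⟩ := hk
  by_contra! h
  have hη' (j) : η j ≠ 0 := norm_ne_zero_iff.1 (hη j ▸ one_ne_zero)
  have hlk₀ := hlk 0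
  have hlk' := hlk j'
  obtain hl₀ | hl₀ | ⟨hl₀, hk₀⟩ : l 0 = 0 ∨ l 0 = d ∨ 0 < l 0 ∧ 0 < k 0 := by omega
  · exact hj (eq_zero_of_shiftMinor_twoRootCoeff_eq_zero hα hd hη' hlk h hl₀ j)
  · have := eq_of_shiftMinor_twoRootCoeff_eq_zero hα hd hη' hlk h hl₀ j'
    omega
  · obtain ⟨i, hi, hne⟩ := exists_shiftMinor_twoRootCoeff_ne_zero_of_first_mem_Ioo hα hd hη hη₀ hη₁
      hη₂ hlk hl₀ hk₀
    exact hne (h i hi)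

lemma exists_shiftMinor_coeff_ne_zero {η : Fin 3 → ℂ}
    (h : shiftMinor α i (fun j => twoRootCoeff (l j) (k j) (η j)) ≠ 0) :
    ∃ ε : ℂ, shiftMinor α i
      (fun j n => ((X + C ε) ^ l j * (X + C (η j)) ^ k j).coeff n) ≠ 0 := by
  by_contra! h₀
  refine h (Polynomial.funext fun ε => ?_)
  rw [eval_zero, ← h₀ ε, ← coe_evalRingHom, map_shiftMinor]
  simp only [coe_evalRingHom, eval_twoRootCoeff]

end TwoRootMinor

section ExchangeExcluded

variable {N d α : ℕ} {l : Fin 3 → ℕ}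

/-- No triple satisfying the binomial relations arises from `z` by an exchange of roots that keeps
`l j` of the roots of the `j`-th component. -/
def ExcludesExchange (α : ℕ) (l : Fin 3 → ℕ) (z : Fin 3 → Fin (d + 1) → ℂ) : Prop :=
  ∀ z', BinomialRelations α z' → ¬ ∀ j, IsRootExchange (l j) (z j) (z' j)

/-- The minor of the binomial relations for the triple obtained by an exchange of roots, as a
polynomial in the roots of the triple (`Sum.inl`) and of its conjugate reversal (`Sum.inr`). -/
noncomputable def exchangeMinor (α i : ℕ) (l : Fin 3 → ℕ) :
    MvPolynomial ((Fin 3 ⊕ Fin 3) × Fin d) ℂ :=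
  shiftMinor α i fun j n => (firstFactors (l j) (fun a => MvPolynomial.X (Sum.inl j, a)) *
    firstFactors (d - l j) (fun a => MvPolynomial.X (Sum.inr j, a))).coeff n

lemma eval_exchangeMinor (α i : ℕ) (l : Fin 3 → ℕ) (r : Fin 3 ⊕ Fin 3 → Fin d → ℂ) :
    MvPolynomial.eval r.uncurry (exchangeMinor α i l) = shiftMinor α i fun j n =>
      (firstFactors (l j) (r (Sum.inl j)) * firstFactors (d - l j) (r (Sum.inr j))).coeff n := by
  rw [exchangeMinor, map_shiftMinor]
  congr 1
  funext j n
  rw [← coeff_map, Polynomial.map_mul, map_firstFactors, map_firstFactors]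
  simp only [Function.comp_def, MvPolynomial.eval_X, Function.uncurry_apply_pair]

lemma exists_eval_ne_zero_of_shiftMinor_ne_zero {i : ℕ} {b c : Fin 3 → ℂ} (hl : ∀ j, l j ≤ d)
    (hi : α + i < d) (h : shiftMinor α i
      (fun j n => ((X - C (b j)) ^ l j * (X - C (c j)) ^ (d - l j)).coeff n) ≠ 0) :
    ∃ Q : MvPolynomial ((Fin 3 × Fin (d + 1)) ⊕ (Fin 3 × Fin (d + 1))) ℂ,
      (∀ y z : Fin 3 × Fin (d + 1) → ℂ, (∀ j, HasRoots (fun n => y (j, n)) fun _ => b j) →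
        (∀ j, HasRoots (fun n => z (j, n.rev)) fun _ => c j) →
        MvPolynomial.eval (Sum.elim y z) Q ≠ 0) ∧
      ∀ z, MvPolynomial.eval (Sum.elim z (star z)) Q ≠ 0 →
        ExcludesExchange α l (Function.curry z) := by
  obtain ⟨Q, hQ, hvanish⟩ := exists_eval_ne_zero_of_hasRoots (b := Sum.elim b c)
    (P := exchangeMinor α i l) (d := d) <| by
      rw [← Function.uncurry_def fun k (_ : Fin d) => Sum.elim b c k, eval_exchangeMinor]
      simpa [firstFactors_const, hl] using h
  let family (y z : Fin 3 × Fin (d + 1) → ℂ) : Fin 3 ⊕ Fin 3 → Fin (d + 1) → ℂ :=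
    Sum.elim (fun j n => y (j, n)) fun j n => z (j, n.rev)
  let reindex (t : (Fin 3 ⊕ Fin 3) × Fin (d + 1)) :
      (Fin 3 × Fin (d + 1)) ⊕ (Fin 3 × Fin (d + 1)) :=
    t.1.map (fun j => (j, t.2)) fun j => (j, t.2.rev)
  have hfamily (y z) : Sum.elim y z ∘ reindex = (family y z).uncurry := by
    funext ⟨k, n⟩
    rcases k with j | j <;> rfl
  refine ⟨MvPolynomial.rename reindex Q, fun y z hy hz => ?_, fun z hz z' hz' hexch => hz ?_⟩
  · rw [MvPolynomial.eval_rename, hfamily]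
    exact hQ _ (Sum.forall.2 ⟨hy, hz⟩)
  · choose r s a hr hs ha hprod using hexch
    rw [MvPolynomial.eval_rename, hfamily]
    refine hvanish _ (Sum.elim r s) (Sum.forall.2 ⟨hr, hs⟩) ?_
    rw [eval_exchangeMinor]
    refine hz'.shiftMinor_eq_zero hi ha fun j n => ?_
    rw [← coeff_C_mul]
    exact (ofFn_coeff_eq_val_of_lt _ n.2).symm.trans (congrArg (coeff · n) (hprod j))

lemma hasRoots_of_eq_choose_mul_pow {y : Fin (d + 1) → ℂ} {a c : ℂ} (hc : c ≠ 0)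
    (h : ∀ n : Fin (d + 1), y n = c * (d.choose n * a ^ (d - (n : ℕ)))) :
    HasRoots y fun _ => -a := by
  have hlast : y (Fin.last d) = c := by simp [h]
  refine ⟨hlast ▸ hc, Polynomial.ext fun n => ?_⟩
  rw [hlast, Finset.prod_const, Finset.card_univ, Fintype.card_fin, C_neg, sub_neg_eq_add,
    coeff_C_mul, coeff_X_add_C_pow]
  rcases lt_or_ge n (d + 1) with hn | hn
  · rw [ofFn_coeff_eq_val_of_lt _ hn, h, mul_comm (a ^ _)]
  · rw [ofFn_coeff_eq_zero_of_ge _ hn, Nat.choose_eq_zero_of_lt hn, Nat.cast_zero, mul_zero,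
      mul_zero]

/-- The signal and window for which every windowed section is a multiple of the coefficients of
`(X + ε) ^ d`. -/
noncomputable def binomialPoint (N d : ℕ) (ε : ℂ) : ZMod N ⊕ Fin (d + 1) → ℂ :=
  Sum.elim 1 fun n => d.choose n * ε ^ (d - (n : ℕ))

/-- The signal and window for which the section at shift `κ`, reversed, is a multiple of the
coefficients of `(X + ψ(-2κ)) ^ d`, where `ψ` is the standard additive character. -/
noncomputable def chirpPoint (N d : ℕ) [NeZero N] : ZMod N ⊕ Fin (d + 1) → ℂ :=
  Sum.elim (fun m => ZMod.stdAddChar (m ^ 2))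
    fun n => d.choose n * ZMod.stdAddChar (-(n : ZMod N) ^ 2)

lemma hasRoots_binomialPoint (ε : ℂ) (j : Fin 3) :
    HasRoots (fun n => complexValue (tripleParam N (d + 1) α) (binomialPoint N d ε) (j, n))
      fun _ => -ε :=
  hasRoots_of_eq_choose_mul_pow one_ne_zero fun n => by
    simp [complexValue_tripleParam, binomialPoint]

lemma hasRoots_chirpPoint [NeZero N] (j : Fin 3) :
    HasRoots (fun n => complexValue (tripleParam N (d + 1) α) (chirpPoint N d) (j, n.rev))
      fun _ => -ZMod.stdAddChar (-2 * (windowShift α j : ZMod N)) := by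
  refine hasRoots_of_eq_choose_mul_pow (c := ZMod.stdAddChar ((windowShift α j : ZMod N) ^ 2))
    (AddChar.val_isUnit _ _).ne_zero fun n => ?_
  have hrev : (n.rev : ℕ) = d - n := by rw [Fin.val_rev, Nat.add_sub_add_right]
  rw [complexValue_tripleParam, chirpPoint, Sum.elim_inl, Sum.elim_inr, mul_left_comm,
    ← AddChar.map_add_eq_mul, ← AddChar.map_nsmul_eq_pow, mul_left_comm,
    ← AddChar.map_add_eq_mul, hrev, Nat.choose_symm n.is_le, nsmul_eq_mul]
  congr 2
  push_cast
  ring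

lemma genericAlong_excludesExchange_of_exists_ne (hα : 0 < α) (hd : α < d) (hN : 2 * α < N)
    (hld : ∀ j, l j ≤ d) (hl : ∃ j, l j ≠ 0) (hl' : ∃ j, l j ≠ d) :
    GenericAlong (tripleParam N (d + 1) α) fun z => ExcludesExchange α l (Function.curry z) := by
  have : NeZero N := ⟨by omega⟩
  let η (j : Fin 3) : ℂ := ZMod.stdAddChar (-2 * (windowShift α j : ZMod N))
  have hα₂ : ((2 * α : ℕ) : ZMod N) ≠ 0 := fun h =>
    (Nat.le_of_dvd (by omega) ((ZMod.natCast_eq_zero_iff _ _).1 h)).not_gt hN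
  have hη {m : ZMod N} (hm : m ≠ 0) : ZMod.stdAddChar m ≠ 1 := fun h =>
    hm (ZMod.injective_stdAddChar (h.trans (AddChar.map_zero_eq_one _).symm))
  obtain ⟨i, hi, h⟩ := exists_shiftMinor_twoRootCoeff_ne_zero hα hd (η := η) (l := l)
    (k := fun j => d - l j) (fun j => AddChar.norm_apply _ _) (by simp [η, windowShift])
    (hη (by simpa [windowShift] using hα₂)) (hη (by simpa [windowShift] using hα₂))
    (fun j => Nat.add_sub_cancel' (hld j)) hl (hl'.imp fun j hj => by have := hld j; omega)
  obtain ⟨ε, hε⟩ := exists_shiftMinor_coeff_ne_zero h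
  obtain ⟨Q, hQ, hexcl⟩ := exists_eval_ne_zero_of_shiftMinor_ne_zero hld hi
    (b := fun _ => -ε) (c := fun j => -η j) (by simpa using hε)
  exact ⟨Q, ⟨binomialPoint N d ε, chirpPoint N d,
    hQ _ _ (hasRoots_binomialPoint ε) hasRoots_chirpPoint⟩, hexcl⟩

/-- The constant window and the signal that is constant except for a single peak, placed so that the
reversal of the section at shift `κ` has its peak in position `α + 1 - κ`. -/
noncomputable def peakPoint (N d α : ℕ) : ZMod N ⊕ Fin (d + 1) → ℂ :=
  Sum.elim (fun m => if m + d = α + 1 then 2 else 1) 1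

lemma complexValue_peakPoint (j : Fin 3) {n : ℕ} (hn : n ≤ d) :
    complexValue (tripleParam N (d + 1) α) (peakPoint N d α) (j, (Fin.ofNat (d + 1) n).rev) =
      if (windowShift α j + n : ZMod N) = α + 1 then 2 else 1 := by
  rw [complexValue_tripleParam, peakPoint, Sum.elim_inl, Sum.elim_inr, Pi.one_apply, mul_one,
    Fin.val_rev, Fin.val_ofNat, Nat.mod_eq_of_lt (Nat.lt_succ_iff.2 hn), Nat.add_sub_add_right,
    show ((windowShift α j - ((d - n : ℕ) : ℤ) : ℤ) : ZMod N) + d = windowShift α j + n by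
      push_cast [hn]; ring]

lemma shiftMinor_peakPoint_ne_zero (hα : 0 < α) (hd : α < d) (hN : 2 * α < N) :
    shiftMinor α 0 (fun j n => complexValue (tripleParam N (d + 1) α) (peakPoint N d α)
      (j, (Fin.ofNat (d + 1) n).rev)) ≠ 0 := by
  have hcast (m : ℕ) (hm : 0 < m) (hmN : m < N) : (m : ZMod N) ≠ 0 := fun h =>
    (Nat.le_of_dvd hm ((ZMod.natCast_eq_zero_iff _ _).1 h)).not_gt hmN
  have h₁ := hcast 1 one_pos (by omega)
  have hα₁ := hcast α hα (by omega)
  have hα₂ := hcast (α + 1) (by omega) (by omega)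
  have hα₃ := hcast (2 * α) (by omega) (by omega)
  push_cast at h₁ hα₁ hα₂ hα₃
  simp (disch := omega) only [shiftMinor, complexValue_peakPoint]
  simp only [windowShift, Matrix.cons_val_zero, Matrix.cons_val_one, Matrix.cons_val]
  push_cast
  rw [if_neg fun h => hα₂ (by linear_combination -h), if_neg fun h => h₁ (by linear_combination -h),
    if_neg fun h => hα₃ (by linear_combination -h), if_neg fun h => hα₁ (by linear_combination h),
    if_neg fun h => hα₁ (by linear_combination -h), if_pos (zero_add _)]
  split_ifs <;> norm_num

lemma genericAlong_excludesExchange_zero (hα : 0 < α) (hd : α < d) (hN : 2 * α < N) :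
    GenericAlong (tripleParam N (d + 1) α)
      fun z => ExcludesExchange α (fun _ => 0) (Function.curry z) := by
  refine ⟨shiftMinor α 0 fun j n => MvPolynomial.X (Sum.inr (j, (Fin.ofNat (d + 1) n).rev)),
    ⟨0, peakPoint N d α, ?_⟩, fun z hz z' hz' hexch => hz ?_⟩
  · rw [map_shiftMinor]
    simpa only [MvPolynomial.eval_X, Sum.elim_inr] using shiftMinor_peakPoint_ne_zero hα hd hN
  · choose a ha hz'a using fun j => (hexch j).exists_eq_smul_conjRev
    rw [map_shiftMinor]
    refine hz'.shiftMinor_eq_zero hd ha fun j n => ?_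
    rw [hz'a]
    simp [conjRev]

lemma genericAlong_excludesExchange (hα : 0 < α) (hd : α < d) (hN : 2 * α < N)
    (hld : ∀ j, l j ≤ d) (hl : ∃ j, l j ≠ d) :
    GenericAlong (tripleParam N (d + 1) α) fun z => ExcludesExchange α l (Function.curry z) := by
  by_cases hl₀ : ∃ j, l j ≠ 0
  · exact genericAlong_excludesExchange_of_exists_ne hα hd hN hld hl₀ hl
  · obtain rfl : l = fun _ => 0 := funext fun j => not_not.1 fun hj => hl₀ ⟨j, hj⟩
    exact genericAlong_excludesExchange_zero hα hd hN

lemma genericAlong_apply_ne_zero {W : ℕ} :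
    GenericAlong (tripleParam N W α) fun z => ∀ t, z t ≠ 0 := by
  refine ⟨∏ t, MvPolynomial.X (Sum.inl t), ⟨1, 1, ?_⟩, fun z hz t => ?_⟩
  · simp [complexValue_tripleParam]
  · simp only [map_prod, MvPolynomial.eval_X, Sum.elim_inl, Finset.prod_ne_zero_iff] at hz
    exact hz t (Finset.mem_univ t)

end ExchangeExcluded

section PhaseRecovery

variable {d α : ℕ} {z z' : Fin 3 → Fin (d + 1) → ℂ}

lemma genericAlong_forall_excludesExchange {N : ℕ} (hα : 0 < α) (hd : α < d) (hN : 2 * α < N) :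
    GenericAlong (tripleParam N (d + 1) α) fun z => ∀ l : Fin 3 → Fin (d + 1),
      (∃ j, l j ≠ Fin.last d) → ExcludesExchange α (fun j => l j) (Function.curry z) := by
  classical
  simpa only [Finset.mem_filter_univ] using GenericAlong.forall_mem
    {l : Fin 3 → Fin (d + 1) | ∃ j, l j ≠ Fin.last d} fun l hl =>
      genericAlong_excludesExchange hα hd hN (fun j => (l j).is_le) <|
        (Finset.mem_filter_univ l).1 hl |>.imp fun _ hj h => hj (Fin.ext h)

lemma BinomialRelations.sq_eq_mul_of_eq_smul {a : Fin 3 → ℂ} (hz : BinomialRelations α z)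
    (hz' : BinomialRelations α z') (hα : α ≤ d) (hz₀ : ∀ n, z 0 n ≠ 0)
    (ha : ∀ j, z' j = a j • z j) : a 0 ^ 2 = a 2 * a 1 := by
  have h := hz 0 ⟨α, by omega⟩ rfl
  have h' := hz' 0 ⟨α, by omega⟩ rfl
  simp only [ha, Pi.smul_apply, smul_eq_mul] at h'
  refine mul_right_cancel₀ (mul_ne_zero (hz₀ 0) (hz₀ ⟨α, by omega⟩)) ?_
  linear_combination h' - a 2 * a 1 * h

lemma exists_angles_of_sq_eq_mul {c : Fin 3 → ℂ} (hc : ∀ j, ‖c j‖ = 1) (h : c 0 ^ 2 = c 2 * c 1) :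
    ∃ θ₀ θα : ℝ, c 0 = Complex.exp (Complex.I * (θ₀ : ℂ)) ∧
      c 1 = Complex.exp (Complex.I * ((θ₀ + θα : ℝ) : ℂ)) ∧
      c 2 = Complex.exp (Complex.I * ((θ₀ - θα : ℝ) : ℂ)) := by
  obtain ⟨t, ht⟩ : ∃ t : Fin 3 → ℝ, ∀ j, c j = Complex.exp (Complex.I * (t j : ℂ)) := by
    refine ⟨fun j => (c j).arg, fun j => ?_⟩
    conv_lhs => rw [← Complex.norm_mul_exp_arg_mul_I (c j), hc j]
    rw [Complex.ofReal_one, one_mul, mul_comm]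
  refine ⟨t 0, t 1 - t 0, ht 0, by rw [add_sub_cancel, ht 1], ?_⟩
  have hc₁ : c 1 ≠ 0 := norm_ne_zero_iff.1 (by rw [hc 1]; exact one_ne_zero)
  refine mul_right_cancel₀ hc₁ ?_
  rw [← h, ht 0, ht 1, ← Complex.exp_nat_mul, ← Complex.exp_add]
  congr 1
  push_cast
  ring

end PhaseRecovery

end BlindSTFT

theorem mainTheorem4_general (N W α : ℕ) (hα : 0 < α) (hN : 2 * α < N) (hW : α + 2 ≤ W) :
    BlindSTFT.HoldsGenerically (BlindSTFT.tripleVariety N W α)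
      (fun z => ∀ z' ∈ BlindSTFT.tripleVariety N W α,
        (∀ j : Fin 3, BlindSTFT.fourierIntensity (z' j) = BlindSTFT.fourierIntensity (z j)) →
        ∃ θ₀ θα : ℝ,
          z' 0 = Complex.exp (Complex.I * (θ₀ : ℂ)) • z 0 ∧
          z' 1 = Complex.exp (Complex.I * ((θ₀ + θα : ℝ) : ℂ)) • z 1 ∧
          z' 2 = Complex.exp (Complex.I * ((θ₀ - θα : ℝ) : ℂ)) • z 2) := by
  obtain ⟨d, rfl⟩ : ∃ d, W = d + 1 := ⟨W - 1, by omega⟩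
  have hgeneric := BlindSTFT.genericAlong_apply_ne_zero.and
    (BlindSTFT.genericAlong_forall_excludesExchange hα (by omega : α < d) hN)
  refine hgeneric.holdsGenerically fun z hz ⟨hne, hexcl⟩ z' hz' hint => ?_
  have hz₀ (j n) : z j n ≠ 0 := hne (j, n)
  have hrel' := BlindSTFT.binomialRelations_of_mem hz'
  choose l hexch using fun j => BlindSTFT.exists_isRootExchange (hint j) (hz₀ j 0) (hz₀ j _)
  have hl (j) : l j = Fin.last d := by
    by_contra hj
    exact hexcl l ⟨j, hj⟩ z' hrel' hexch
  choose a ha using fun j => BlindSTFT.IsRootExchange.exists_eq_smul (d := d) (hl j ▸ hexch j)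
  have hnorm (j) : ‖a j‖ = 1 := BlindSTFT.norm_eq_one_of_fourierIntensity_smul_eq
    (fun h => hz₀ j 0 (congrFun h 0)) (ha j ▸ hint j)
  have hsq := (BlindSTFT.binomialRelations_of_mem hz).sq_eq_mul_of_eq_smul hrel' (by omega)
    (hz₀ 0) ha
  obtain ⟨θ₀, θα, h₀, h₁, h₂⟩ := BlindSTFT.exists_angles_of_sq_eq_mul hnorm hsq
  exact ⟨θ₀, θα, h₀ ▸ ha 0, h₁ ▸ ha 1, h₂ ▸ ha 2⟩

theorem mainTheorem4 (N W L : ℕ) (hWN : W ≤ N)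
    (hR : 3 ≤ N / Nat.gcd L N) (hW : Nat.gcd L N + 2 ≤ W) :
    BlindSTFT.HoldsGenerically (BlindSTFT.tripleVariety N W (Nat.gcd L N))
      (fun z => ∀ z' ∈ BlindSTFT.tripleVariety N W (Nat.gcd L N),
        (∀ j : Fin 3, BlindSTFT.fourierIntensity (z' j) = BlindSTFT.fourierIntensity (z j)) →
        ∃ θ₀ θα : ℝ,
          z' 0 = Complex.exp (Complex.I * (θ₀ : ℂ)) • z 0 ∧
          z' 1 = Complex.exp (Complex.I * ((θ₀ + θα : ℝ) : ℂ)) • z 1 ∧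
          z' 2 = Complex.exp (Complex.I * ((θ₀ - θα : ℝ) : ℂ)) • z 2) := by
  have hα : 0 < Nat.gcd L N := Nat.gcd_pos_of_pos_right _ (by omega)
  have hN : 3 * Nat.gcd L N ≤ N := (Nat.le_div_iff_mul_le hα).1 hR
  exact mainTheorem4_general N W _ hα (by omega) hW
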